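/- Let $\mathcal A$ be a unital JB-algebra, i.e. a unital real Jordan algebra (a real vector space with a commutative bilinear product $\circ$ satisfying $(a^2\circ b)\circ a=a^2\circ(b\circ a)$ and a unit $I$) with a complete norm such that $\|a\circ b\|\le\|a\|\,\|b\|$, $\|a^2\|=\|a\|^2$ and $\|a^2\|\le\|a^2+b^2\|$ for all $a,b\in\mathcal A$. An element $a$ is invertible, with Jordan inverse $a^{-1}=b$, if $a\circ b=I$ and $a^2\circ b=a$ for some $b\in\mathcal A$; its spectrum is the set of $\lambda\in\mathbb R$ for which $a-\lambda I$ is not invertible; and $a$ is positive if its spectrum is contained in $[0,\infty)$. For $a,b\in\mathcal A$ put $\{aba\}=2(a\circ b)\circ a-a^2\circ b$, and for $f$ continuous on the spectrum of $a$ let $f(a)$ be defined by the continuous functional calculus, i.e. $f(a)=\Phi(f)$ where $\Phi$ is the unique continuous unital algebra homomorphism from the real continuous functions on the spectrum of $a$ to $\mathcal A$ that maps the identity function to $a$. For positive invertible $A,B\in\mathcal A$ let $$S(A|B)=\Big\{A^{1/2}\log\big(\{A^{-1/2}BA^{-1/2}\}\big)A^{1/2}\Big\}$$ be the relative operator entropy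 and, for $t\in[0,1]$, let $$A\,!_t\,B=\big((1-t)A^{-1}+tB^{-1}\big)^{-1}$$ be the weighted harmonic mean. **Theorem.** Let $A,B$ be positive invertible elements of a unital JB-algebra. Then $(1-t)A^{-1}+tB^{-1}$ is invertible for every $t\in[0,1]$, the function $t\mapsto \frac{A\,!_t\,B-A}{t}$ is (Bochner) integrable on $(0,1)$, and $$S(A|B)=\int_0^1\frac{A\,!_t\,B-A}{t}\,dt .$$ -/

import Mathlib

noncomputable section

/-- A unital JB-algebra: a unital real Jordan algebra (the Jordan product is `*`, which is
commutative, bilinear and satisfies the Jordan identity) with a complete norm such that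
`‖a ∘ b‖ ≤ ‖a‖ ‖b‖`, `‖a²‖ = ‖a‖²` and `‖a²‖ ≤ ‖a² + b²‖`. -/
class UnitalJBAlgebra (A : Type*) extends NormedAddCommGroup A, NonAssocCommRing A,
    NormedSpace ℝ A, CompleteSpace A, IsCommJordan A, IsScalarTower ℝ A A,
    SMulCommClass ℝ A A where
  norm_jmul_le : ∀ a b : A, ‖a * b‖ ≤ ‖a‖ * ‖b‖
  norm_sq_eq : ∀ a : A, ‖a * a‖ = ‖a‖ ^ 2
  norm_sq_le_add : ∀ a b : A, ‖a * a‖ ≤ ‖a * a + b * b‖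

namespace UnitalJBAlgebra

variable {A : Type*} [UnitalJBAlgebra A]

/-- `b` is a Jordan inverse of `a`: `a ∘ b = 1` and `a² ∘ b = a`. -/
def IsJordanInverse (a b : A) : Prop := a * b = 1 ∧ (a * a) * b = a

/-- `a` is invertible in the Jordan sense. -/
def IsJordanInvertible (a : A) : Prop := ∃ b : A, IsJordanInverse a b

open Classical in
/-- The Jordan inverse `a⁻¹` of an invertible element (`0` if `a` is not invertible). -/
def jinv (a : A) : A := if h : IsJordanInvertible a then h.choose else 0

/-- The spectrum: all real `r` such that `a - r 1` is not invertible in the Jordan sense. -/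
def jspectrum (a : A) : Set ℝ := {r : ℝ | ¬ IsJordanInvertible (a - r • (1 : A))}

/-- `a` is positive if its spectrum is contained in `[0, ∞)`. -/
def IsJordanPositive (a : A) : Prop := jspectrum a ⊆ Set.Ici 0

/-- The map `U_a b = {a b a} = 2 (a ∘ b) ∘ a - a² ∘ b`. -/
def U (a b : A) : A := (2 : ℝ) • ((a * b) * a) - (a * a) * b

/-- `Φ : C(Sp a, ℝ) → A` is the continuous functional calculus of `a`: a continuous unital
homomorphism of real algebras that maps the identity function of the spectrum to `a`. (The topology
on `C(Sp a, ℝ)` is that of uniform convergence, as the spectrum is compact. There is exactly one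
such `Φ`, by density of the polynomials.) -/
structure IsFunctionalCalculus (a : A) (Φ : C(jspectrum a, ℝ) →ₙₐ[ℝ] A) : Prop where
  map_one : Φ 1 = 1
  map_id : Φ ⟨Subtype.val, continuous_subtype_val⟩ = a
  continuous : Continuous Φ

open Classical in
/-- `f(a)` by continuous functional calculus, for `f` continuous on the spectrum of `a`. -/
def jcfc (f : ℝ → ℝ) (a : A) : A :=
  if h : (∃ Φ : C(jspectrum a, ℝ) →ₙₐ[ℝ] A, IsFunctionalCalculus a Φ) ∧
      ContinuousOn f (jspectrum a) then
    h.1.choose ⟨(jspectrum a).domRestrict f, h.2.domRestrict⟩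
  else 0

/-- The power `a ^ s` of a positive invertible element, by functional calculus. -/
def jpow (a : A) (s : ℝ) : A := jcfc (fun x : ℝ => x ^ s) a

/-- The logarithm of a positive invertible element, by functional calculus. -/
def jlog (a : A) : A := jcfc Real.log a

/-- The relative operator entropy `S(a|b) = {a^{1/2} log({a^{-1/2} b a^{-1/2}}) a^{1/2}}`. -/
def relativeOperatorEntropy (a b : A) : A :=
  U (jpow a (1 / 2)) (jlog (U (jpow a (-(1 / 2))) b))

/-- The weighted harmonic mean `a !_t b = ((1 - t) a⁻¹ + t b⁻¹)⁻¹`. -/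
def harmonicMean (t : ℝ) (a b : A) : A := jinv ((1 - t) • jinv a + t • jinv b)

end UnitalJBAlgebra

end

/-!
The two elements `a` and `b` are reduced to a single one. With `s = a^{1/2}` and `c = U_s⁻¹ b`, the
inversion rule `(U_s x)⁻¹ = U_{s⁻¹} x⁻¹` gives `a !_t b = U_s (1 !_t c)`, and `S(a|b) = U_s (log c)`
by definition. Everything about `1` and `c` takes place in the functional calculus of `c`, where
`(1 !_t x - 1) / t = (x - 1) / ((1 - t) x + t)` is a continuous family of functions of `x` even at
`t = 0`, with integral `log x` over `[0, 1]`. The bounded linear map `f ↦ U_s (f(c))` commutes with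
the integral.

The inversion rule rests on the fundamental formula `U_{U_x y} = U_x U_y U_x`
(`fundamental_formula`), derived here from the five-linear identity `tri_tri` of the Jordan triple
product.

The functional calculus (`exists_isFunctionalCalculus`) is built without complexification. In the
closed subalgebra generated by one element, which is associative, call `x` positive if
`‖s - x‖ ≤ s` for some `s ≥ 0` (`NormPos`). Elements with `‖s - x‖ < s` are invertible and are
squares; conversely squares are positive by the norm axioms (`normPos_sq`), and the norm is the
order unit norm of this closed cone (`norm_le_of_normPos`). Its boundary consists of non-invertible
elements, so that polynomials that are nonnegative on the spectrum are positive (`normPos_aeval`),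
which bounds the norm of a polynomial in `a` by its supremum on the spectrum (`norm_aeval_le`); the
Weierstrass theorem does the rest. An element that is invertible in the Jordan sense is
invertible in every such subalgebra containing it, because `U_x` is bijective
(`isUnit_iff_isJordanInvertible`).

For the logarithm of `c` to make sense `c` has to be positive. This follows from the same
description of the boundary of the cone: `U_s` keeps the segment from `1` to `b`
invertible, so its image cannot leave the cone (`NormPos.U`).
-/

noncomputable section

namespace UnitalJBAlgebra

/-! ### The Jordan triple product and the fundamental formula -/

section Jordan

variable {A : Type*} [UnitalJBAlgebra A]

/-- The linearised Jordan identity. -/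
lemma jordan_linearized (a b c d : A) :
    a * ((b * c) * d) + b * ((c * a) * d) + c * ((a * b) * d) =
      (b * c) * (a * d) + (c * a) * (b * d) + (a * b) * (c * d) := by
  have h := congrArg (fun T : AddMonoid.End A => T d)
    (two_nsmul_lie_lmul_lmul_add_add_eq_zero a b c)
  have h' : 2 • (a * (b * c * d) - b * c * (a * d) + (b * (c * a * d) - c * a * (b * d)) +
    (c * (a * b * d) - a * b * (c * d))) = 0 := h
  rw [two_nsmul, ← two_smul ℝ] at h'
  have h2 := (smul_eq_zero.1 h').resolve_left two_ne_zero
  linear_combination (norm := module) h2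

/-- The Jordan triple product `{x y z}`. -/
def tri (x y z : A) : A := (x * y) * z + (y * z) * x - (x * z) * y

lemma tri_comm (x y z : A) : tri x y z = tri z y x := by
  simp only [tri, mul_comm]; abel

lemma tri_add_left (x x' y z : A) : tri (x + x') y z = tri x y z + tri x' y z := by
  simp only [tri, mul_add, add_mul]; abel

lemma tri_add_mid (x y y' z : A) : tri x (y + y') z = tri x y z + tri x y' z := by
  simp only [tri, mul_add, add_mul]; abel

lemma tri_sub_mid (x y y' z : A) : tri x (y - y') z = tri x y z - tri x y' z := by
  simp only [tri, mul_sub, sub_mul]; abel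

lemma tri_smul_mid (r : ℝ) (x y z : A) : tri x (r • y) z = r • tri x y z := by
  simp only [tri, mul_smul_comm, smul_mul_assoc, smul_sub, smul_add]

lemma U_eq_tri (x y : A) : U x y = tri x y x := by
  simp only [U, tri, two_smul, mul_comm]

/-- The inner derivation `[L_x, L_y]`. -/
def innerDer (x y z : A) : A := x * (y * z) - y * (x * z)

/-- Inner derivations satisfy the Leibniz rule. -/
lemma innerDer_mul (x y z w : A) :
    innerDer x y (z * w) = innerDer x y z * w + z * innerDer x y w := by
  have h1 := jordan_linearized x z w y
  have h2 := jordan_linearized y z w x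
  simp only [innerDer, mul_sub, sub_mul]
  simp only [mul_comm] at h1 h2 ⊢
  linear_combination (norm := module) h1 - h2

lemma innerDer_add (x y z w : A) : innerDer x y (z + w) = innerDer x y z + innerDer x y w := by
  simp only [innerDer, mul_add]; abel

lemma innerDer_sub (x y z w : A) : innerDer x y (z - w) = innerDer x y z - innerDer x y w := by
  simp only [innerDer, mul_sub]; abel

lemma innerDer_tri (x y u v w : A) : innerDer x y (tri u v w) =
    tri (innerDer x y u) v w + tri u (innerDer x y v) w + tri u v (innerDer x y w) := by
  simp only [tri, innerDer_add, innerDer_sub, innerDer_mul, add_mul]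
  abel

/-- Multiplications lie in the structure Lie algebra of the triple product: `L_a` acts with the
opposite sign on the middle variable. -/
lemma mul_tri (a u v w : A) :
    a * tri u v w = tri (a * u) v w - tri u (a * v) w + tri u v (a * w) := by
  have h1 := jordan_linearized a u v w
  have h2 := jordan_linearized a v w u
  have h3 := jordan_linearized a u w v
  simp only [tri, mul_add, mul_sub]
  simp only [mul_comm] at h1 h2 h3 ⊢
  linear_combination (norm := module) h1 + h2 - h3

lemma tri_eq_mul_add_innerDer (x y z : A) : tri x y z = (x * y) * z + innerDer x y z := by
  simp only [tri, innerDer, mul_comm]; abel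

lemma tri_eq_mul_sub_innerDer (x y z : A) : tri y x z = (x * y) * z - innerDer x y z := by
  simp only [tri, innerDer, mul_comm]; abel

/-- The five-linear identity, which makes a Jordan algebra into a Jordan triple system. -/
lemma tri_tri (x y u v w : A) :
    tri x y (tri u v w) =
      tri (tri x y u) v w - tri u (tri y x v) w + tri u v (tri x y w) := by
  have hr : ∀ p q : A, tri u v (p + q) = tri u v p + tri u v q := fun p q => by
    rw [tri_comm u v, tri_add_left, tri_comm p, tri_comm q]
  rw [tri_eq_mul_add_innerDer x y (tri u v w), mul_tri, innerDer_tri,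
    tri_eq_mul_add_innerDer x y u, tri_eq_mul_sub_innerDer x y v, tri_eq_mul_add_innerDer x y w,
    tri_add_left, tri_sub_mid, hr]
  abel

lemma tri_tri_self_aux (x y z : A) :
    tri x y (tri x z x) = (2 : ℝ) • tri (tri x y x) z x - tri x (tri y x z) x := by
  rw [tri_tri, tri_comm x z (tri x y x)]; module

/-- `V_{x,y} U_x = U_x V_{y,x}`. -/
lemma tri_tri_self (x y z : A) : tri x y (tri x z x) = tri x (tri y x z) x := by
  have h1 := tri_tri_self_aux x y z
  have h2 := tri_tri_self_aux x z y
  rw [tri_comm (tri x y x) z x] at h1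
  rw [tri_comm (tri x z x) y x, tri_comm z x y] at h2
  -- with `P`, `R` the two sides and `Q = {x z {x y x}}`, the hypotheses say `P = 2Q - R` and
  -- `Q = 2P - R`, whence `3P = 3R`
  linear_combination (norm := module) (-1 / 3 : ℝ) • h1 - (2 / 3 : ℝ) • h2

/-- The fundamental formula `U_{U_x y} = U_x U_y U_x`. -/
theorem fundamental_formula (x y z : A) : U (U x y) z = U x (U y (U x z)) := by
  simp only [U_eq_tri]
  set w := tri x y x with hw
  have hxw : tri x z w = tri x (tri y x z) x := by
    rw [hw, tri_tri_self, tri_comm z x y]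
  have h1 : tri x y (tri x z w) = tri x (tri y x (tri y x z)) x := by
    rw [hxw, tri_tri_self]
  have h2 := tri_tri x y x z w
  have h3 : tri x (tri y x z) w = tri x (tri y x (tri y x z)) x := by
    rw [hw, tri_tri_self, tri_comm _ x y]
  have h4 : tri x z (tri x y w) = tri x (tri z x (tri y x y)) x := by
    rw [hw, tri_tri_self x y y, tri_tri_self]
  -- `V_{z,x}` applied to `{y x y}` expresses `{y {x z x} y}` through the terms above
  have h5 := tri_tri z x y x y
  rw [tri_comm y x (tri z x y), tri_comm z x y] at h5
  have h6 : tri (tri y x z) x y = tri y x (tri y x z) := tri_comm _ _ _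
  rw [h6] at h5
  have h7 : tri x (tri y (tri x z x) y) x =
      (2 : ℝ) • tri x (tri y x (tri y x z)) x - tri x (tri z x (tri y x y)) x := by
    rw [← tri_smul_mid, ← tri_sub_mid]
    congr 1
    linear_combination (norm := module) h5
  rw [h7]
  rw [h1, h3, h4] at h2
  linear_combination (norm := module) -h2

/-! ### Jordan inverses -/

/-- The quadratic operator `U_x` as a linear map. -/
def UL (x : A) : A →ₗ[ℝ] A where
  toFun := U x
  map_add' y z := by simp only [U_eq_tri, tri_add_mid]
  map_smul' r y := by simp only [U_eq_tri, tri_smul_mid, RingHom.id_apply]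

@[simp] lemma UL_apply (x y : A) : UL x y = U x y := rfl

lemma U_one_left (x : A) : U 1 x = x := by
  simp only [U, one_mul, mul_one]; module

lemma U_one_right (x : A) : U x 1 = x * x := by
  simp only [U, mul_one]; module

/-- `U_x` and `L_x` commute. -/
lemma U_mul_comm (x y : A) : U x (x * y) = x * U x y := by
  have h := IsCommJordan.lmul_comm_rmul_rmul x y
  simp only [U, mul_sub, mul_smul_comm]
  simp only [mul_comm] at h ⊢
  linear_combination (norm := module) -h

lemma IsJordanInverse.U_apply {a b : A} (h : IsJordanInverse a b) : U a b = a := by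
  simp only [U, h.1, h.2, one_mul]; module

/-- `U_a a⁻² = 1`, which makes `U_a` bijective by the fundamental formula. -/
lemma IsJordanInverse.U_apply_sq {a b : A} (h : IsJordanInverse a b) : U a (b * b) = 1 := by
  have hab := h.1
  have hba : b * a = 1 := by rw [mul_comm, hab]
  have h1 := jordan_linearized a a b b
  have h2 := jordan_linearized b b a a
  simp only [hab, hba, h.2, one_mul, mul_one] at h1 h2
  have e1 : (a * a) * (b * b) = 1 := by
    linear_combination (norm := module) -h1
  have e2 : a * (b * b * a) = 1 := by
    rw [mul_comm (b * b) (a * a), e1] at h2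
    linear_combination (norm := module) h2
  simp only [U]
  rw [mul_comm (a * (b * b)) a, mul_comm a (b * b), e1, e2]
  module

/-- `U_a U_b = 1` for a Jordan inverse `b` of `a`. -/
lemma IsJordanInverse.U_U {a b : A} (h : IsJordanInverse a b) (x : A) : U a (U b x) = x := by
  have hs : ∀ y, U a (U (b * b) (U a y)) = y := fun y => by
    rw [← fundamental_formula, h.U_apply_sq, U_one_left]
  have hsurj : ∃ y, U a y = x := ⟨_, hs x⟩
  obtain ⟨y, rfl⟩ := hsurj
  rw [← fundamental_formula, h.U_apply]

lemma IsJordanInverse.U_U' {a b : A} (h : IsJordanInverse a b) (x : A) : U b (U a x) = x := by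
  have hs : ∀ y, U a (U (b * b) (U a y)) = y := fun y => by
    rw [← fundamental_formula, h.U_apply_sq, U_one_left]
  have h1 := h.U_U (U a x)
  rw [← hs (U b (U a x)), h1, hs]

/-- An element `a` with bijective `U_a` is invertible, with inverse `U_a⁻¹ a`; here only the
surjectivity at `a` and the injectivity of `U_a` are needed. -/
lemma isJordanInverse_of_U {a b : A} (hinj : Function.Injective (U a)) (hb : U a b = a) :
    IsJordanInverse a b := by
  have h1 : a * b = 1 := hinj (by rw [U_mul_comm, hb, U_one_right])
  refine ⟨h1, ?_⟩
  have h2 := hb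
  simp only [U, h1, one_mul] at h2
  linear_combination (norm := module) -h2

lemma IsJordanInverse.unique {a b c : A} (hb : IsJordanInverse a b) (hc : IsJordanInverse a c) :
    b = c := by
  rw [← hb.U_U' b, hb.U_apply, ← hc.U_apply, hb.U_U']

lemma IsJordanInvertible.isJordanInverse_jinv {a : A} (h : IsJordanInvertible a) :
    IsJordanInverse a (jinv a) := by
  rw [jinv, dif_pos h]; exact h.choose_spec

lemma IsJordanInverse.isJordanInvertible {a b : A} (h : IsJordanInverse a b) :
    IsJordanInvertible a := ⟨b, h⟩

lemma IsJordanInverse.jinv_eq {a b : A} (h : IsJordanInverse a b) : jinv a = b :=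
  h.isJordanInvertible.isJordanInverse_jinv.unique h

/-- `(U_a c)⁻¹ = U_{a⁻¹} c⁻¹`. -/
lemma IsJordanInverse.U {a b c d : A} (hab : IsJordanInverse a b) (hcd : IsJordanInverse c d) :
    IsJordanInverse (U a c) (U b d) := by
  refine isJordanInverse_of_U (fun x y hxy => ?_) ?_
  · simp only [fundamental_formula] at hxy
    rw [← hab.U_U' x, ← hab.U_U' y, ← hcd.U_U' (UnitalJBAlgebra.U a x),
      ← hcd.U_U' (UnitalJBAlgebra.U a y),
      ← hab.U_U' (UnitalJBAlgebra.U c (UnitalJBAlgebra.U a x)), hxy, hab.U_U']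
  · rw [fundamental_formula, hab.U_U, hcd.U_apply]

lemma IsJordanInverse.symm {a b : A} (h : IsJordanInverse a b) : IsJordanInverse b a := by
  refine isJordanInverse_of_U (fun x y hxy => ?_) ?_
  · rw [← h.U_U x, hxy, h.U_U]
  · conv_lhs => rw [← h.U_apply]
    rw [h.U_U']

end Jordan

open Polynomial Filter Topology

/-! ### The norm cone -/

section NormPos

variable {E : Type*} [NormedAddCommGroup E] [NormedSpace ℝ E] [One E]

/-- Positivity expressed by the norm alone: `x` lies in a ball of radius `s` about `s • 1`. In a
JB-algebra these are exactly the elements with nonnegative spectrum; the definition makes sense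
both in a JB-algebra and in its associative subalgebras. -/
def NormPos (x : E) : Prop := ∃ s : ℝ, 0 ≤ s ∧ ‖s • (1 : E) - x‖ ≤ s

lemma NormPos.add {x y : E} (hx : NormPos x) (hy : NormPos y) : NormPos (x + y) := by
  obtain ⟨s, hs, hx⟩ := hx
  obtain ⟨t, ht, hy⟩ := hy
  refine ⟨s + t, by positivity, ?_⟩
  calc ‖(s + t) • (1 : E) - (x + y)‖ = ‖(s • (1 : E) - x) + (t • (1 : E) - y)‖ := by
        congr 1; module
    _ ≤ _ := (norm_add_le _ _).trans (add_le_add hx hy)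

lemma NormPos.smul {x : E} (hx : NormPos x) {r : ℝ} (hr : 0 ≤ r) : NormPos (r • x) := by
  obtain ⟨s, hs, hx⟩ := hx
  refine ⟨r * s, by positivity, ?_⟩
  rw [mul_smul, ← smul_sub, norm_smul, Real.norm_of_nonneg hr]
  gcongr

lemma normPos_one : NormPos (1 : E) := ⟨1, zero_le_one, by simp⟩

lemma normPos_smul_one {r : ℝ} (hr : 0 ≤ r) : NormPos (r • (1 : E)) := normPos_one.smul hr

lemma normPos_smul_one_add {x : E} {r : ℝ} (hr : ‖x‖ ≤ r) : NormPos (r • (1 : E) + x) :=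
  ⟨r, (norm_nonneg x).trans hr, by simpa using hr⟩

lemma normPos_smul_one_sub {x : E} {r : ℝ} (hr : ‖x‖ ≤ r) : NormPos (r • (1 : E) - x) := by
  rw [sub_eq_add_neg]; exact normPos_smul_one_add (by rwa [norm_neg])

end NormPos

/-! ### Associative JB-algebras -/

/-- A commutative real normed algebra satisfying the norm axioms of a JB-algebra. -/
class IsAssocJB (B : Type*) [NormedCommRing B] : Prop where
  norm_sq_eq : ∀ a : B, ‖a * a‖ = ‖a‖ ^ 2
  norm_sq_le_add : ∀ a b : B, ‖a * a‖ ≤ ‖a * a + b * b‖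

section Assoc

variable {B : Type*} [NormedCommRing B] [NormedAlgebra ℝ B]

lemma norm_smul_one_le [IsAssocJB B] {r : ℝ} (hr : 0 ≤ r) : ‖r • (1 : B)‖ ≤ r := by
  have h := IsAssocJB.norm_sq_eq (1 : B)
  rw [mul_one] at h
  have h1 : ‖(1 : B)‖ ≤ 1 := by nlinarith [norm_nonneg (1 : B)]
  rw [norm_smul, Real.norm_of_nonneg hr]
  nlinarith

variable [CompleteSpace B]

/-- The square root of `1 - w` is `1 - z`, where `z` is the fixed point of the contraction
`z ↦ (w + z²) / 2` of the ball of radius `‖w‖`. -/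
lemma exists_sq_eq_one_sub {w : B} (hw : ‖w‖ < 1) : ∃ y : B, y * y = 1 - w := by
  set f : B → B := fun z => (1 / 2 : ℝ) • (w + z * z) with hf
  have hmaps : Set.MapsTo f (Metric.closedBall 0 ‖w‖) (Metric.closedBall 0 ‖w‖) := by
    intro z hz
    rw [mem_closedBall_zero_iff] at hz ⊢
    have h1 : ‖w + z * z‖ ≤ ‖w‖ + ‖z‖ * ‖z‖ :=
      (norm_add_le _ _).trans (by gcongr; exact norm_mul_le _ _)
    rw [hf, norm_smul]
    norm_num
    nlinarith [norm_nonneg z, norm_nonneg w]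
  have hc : ContractingWith ‖w‖₊ (hmaps.restrict f _ _) := by
    refine ⟨by exact_mod_cast hw, LipschitzWith.of_dist_le_mul ?_⟩
    rintro ⟨x, hx⟩ ⟨y, hy⟩
    rw [mem_closedBall_zero_iff] at hx hy
    simp only [Subtype.dist_eq, Set.MapsTo.val_restrict_apply, hf, dist_eq_norm, coe_nnnorm]
    have h1 : (1 / 2 : ℝ) • (w + x * x) - (1 / 2 : ℝ) • (w + y * y) =
        (1 / 2 : ℝ) • ((x + y) * (x - y)) := by
      rw [← smul_sub]; congr 1; ring
    rw [h1, norm_smul]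
    have h2 : ‖(x + y) * (x - y)‖ ≤ (‖w‖ + ‖w‖) * ‖x - y‖ :=
      (norm_mul_le _ _).trans (by gcongr; exact (norm_add_le _ _).trans (add_le_add hx hy))
    norm_num
    linarith
  obtain ⟨z, -, hz, -⟩ := hc.exists_fixedPoint' (s := Metric.closedBall (0 : B) ‖w‖)
    Metric.isClosed_closedBall.isComplete hmaps (x := 0) (by simp) (edist_ne_top _ _)
  refine ⟨1 - z, ?_⟩
  have hz' : (1 / 2 : ℝ) • (w + z * z) = z := hz
  have h2 : w + z * z = z + z := by
    rw [← two_smul ℝ z]; nth_rw 3 [← hz']; rw [smul_smul]; norm_num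
  linear_combination h2

lemma isUnit_of_norm_lt {x : B} {r : ℝ} (h : ‖r • (1 : B) - x‖ < r) : IsUnit x := by
  have hr : 0 < r := (norm_nonneg _).trans_lt h
  have h1 : ‖r⁻¹ • (r • (1 : B) - x)‖ < 1 := by
    rw [norm_smul, norm_inv, Real.norm_of_nonneg hr.le, inv_mul_lt_iff₀ hr]; simpa using h
  have h2 := (Units.oneSub _ h1).isUnit
  rw [Units.val_oneSub, smul_sub, smul_smul, inv_mul_cancel₀ hr.ne', one_smul, sub_sub_cancel] at h2
  have h3 := h2.smul (Units.mk0 r hr.ne')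
  simpa [Units.smul_def, smul_smul, hr.ne'] using h3

lemma NormPos.isUnit {x : B} (hx : NormPos x) {ε : ℝ} (hε : 0 < ε) : IsUnit (x + ε • 1) := by
  obtain ⟨s, hs, h⟩ := hx
  refine isUnit_of_norm_lt (r := s + ε) ?_
  rw [show (s + ε) • (1 : B) - (x + ε • 1) = s • 1 - x by module]
  linarith

lemma exists_sq_of_norm_lt {x : B} {r : ℝ} (h : ‖r • (1 : B) - x‖ < r) : ∃ y : B, y * y = x := by
  have hr : 0 < r := (norm_nonneg _).trans_lt h
  obtain ⟨y, hy⟩ := exists_sq_eq_one_sub (w := r⁻¹ • (r • (1 : B) - x)) (by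
    rw [norm_smul, norm_inv, Real.norm_of_nonneg hr.le, inv_mul_lt_iff₀ hr]; simpa using h)
  refine ⟨√r • y, ?_⟩
  rw [smul_mul_smul_comm, Real.mul_self_sqrt hr.le, hy, smul_sub, smul_smul, mul_inv_cancel₀ hr.ne']
  module

lemma NormPos.exists_sq {x : B} (hx : NormPos x) {ε : ℝ} (hε : 0 < ε) :
    ∃ y : B, y * y = x + ε • 1 := by
  obtain ⟨s, hs, h⟩ := hx
  refine exists_sq_of_norm_lt (r := s + ε) ?_
  rw [show (s + ε) • (1 : B) - (x + ε • 1) = s • 1 - x by module]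
  linarith

variable [IsAssocJB B]

/-- Squares are positive: `r - x²` is itself a square `y²` for `r > ‖x²‖`, so that
`‖r - x²‖ = ‖y²‖ ≤ ‖y² + x²‖ ≤ r`. -/
lemma normPos_sq (x : B) : NormPos (x * x) := by
  obtain ⟨y, hy⟩ := exists_sq_of_norm_lt (x := (‖x * x‖ + 1) • (1 : B) - x * x)
    (r := ‖x * x‖ + 1) (by rw [sub_sub_cancel]; linarith)
  refine ⟨‖x * x‖ + 1, by positivity, ?_⟩
  rw [← hy]
  refine (IsAssocJB.norm_sq_le_add y x).trans ?_
  rw [hy, sub_add_cancel]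
  exact norm_smul_one_le (by positivity)

/-- The norm is the order unit norm of the cone. -/
lemma norm_le_of_normPos {x : B} {r : ℝ} (hr : 0 ≤ r) (h1 : NormPos (r • (1 : B) + x))
    (h2 : NormPos (r • (1 : B) - x)) : ‖x‖ ≤ r := by
  refine le_of_forall_pos_le_add fun ε hε => ?_
  obtain ⟨u, hu⟩ := h1.exists_sq hε
  obtain ⟨v, hv⟩ := h2.exists_sq hε
  have h3 : x * x + (u * v) * (u * v) = ((r + ε) * (r + ε)) • (1 : B) := by
    have : (u * v) * (u * v) = (u * u) * (v * v) := by ring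
    rw [this, hu, hv]
    simp only [Algebra.smul_def, mul_one, map_mul, map_add]
    ring
  have h4 := IsAssocJB.norm_sq_le_add x (u * v)
  rw [h3, IsAssocJB.norm_sq_eq] at h4
  have h5 := h4.trans (norm_smul_one_le (by positivity))
  rw [← sq] at h5
  exact (pow_le_pow_iff_left₀ (norm_nonneg x) (by positivity) two_ne_zero).1 h5

/-- The radius in the definition of `NormPos` can be any number `≥ ‖x‖`, so that the cone is
closed. -/
lemma NormPos.norm_sub_le {x : B} (hx : NormPos x) {R : ℝ} (hR : ‖x‖ ≤ R) :
    ‖R • (1 : B) - x‖ ≤ R := by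
  have h0 := (norm_nonneg x).trans hR
  refine norm_le_of_normPos h0 ?_ (by rwa [sub_sub_cancel])
  exact (normPos_smul_one h0).add (normPos_smul_one_sub hR)

lemma normPos_iff_norm {x : B} : NormPos x ↔ ‖‖x‖ • (1 : B) - x‖ ≤ ‖x‖ :=
  ⟨fun h => h.norm_sub_le le_rfl, fun h => ⟨_, norm_nonneg x, h⟩⟩

lemma isClosed_normPos_assoc : IsClosed {x : B | NormPos x} := by
  simp only [normPos_iff_norm]
  exact isClosed_le (by fun_prop) (by fun_prop)

/-- Up to `ε`, a product of positive elements is a product of squares, hence a square. -/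
lemma NormPos.mul {x y : B} (hx : NormPos x) (hy : NormPos y) : NormPos (x * y) := by
  have h1 : ∀ᶠ ε : ℝ in 𝓝[>] 0, (x + ε • 1) * (y + ε • 1) ∈ {x : B | NormPos x} := by
    filter_upwards [self_mem_nhdsWithin] with ε hε
    obtain ⟨u, hu⟩ := hx.exists_sq hε
    obtain ⟨v, hv⟩ := hy.exists_sq hε
    rw [← hu, ← hv, mul_mul_mul_comm]
    exact normPos_sq _
  have h2 : Tendsto (fun ε : ℝ => (x + ε • 1) * (y + ε • 1)) (𝓝[>] 0) (𝓝 (x * y)) := by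
    have : Continuous (fun ε : ℝ => (x + ε • 1) * (y + ε • 1)) := by fun_prop
    simpa using (this.tendsto 0).mono_left nhdsWithin_le_nhds
  exact isClosed_normPos_assoc.mem_of_tendsto h2 h1

/-- An invertible positive `x` is an interior point of the cone: `x - δ = x (1 - δ x⁻¹)` is a
product of positive elements for small `δ`. -/
lemma NormPos.exists_sub_of_isUnit {x : B} (hx : NormPos x) (hu : IsUnit x) :
    ∃ ε : ℝ, 0 < ε ∧ NormPos (x - ε • 1) := by
  obtain ⟨y, hy⟩ := hu.exists_right_inv
  refine ⟨(‖y‖ + 1)⁻¹, by positivity, ?_⟩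
  have h1 : x - (‖y‖ + 1)⁻¹ • 1 = x * (1 - (‖y‖ + 1)⁻¹ • y) := by
    rw [mul_sub, mul_smul_comm, hy, mul_one]
  rw [h1]
  refine hx.mul ⟨1, zero_le_one, ?_⟩
  rw [one_smul, sub_sub_cancel, norm_smul, norm_inv, Real.norm_of_nonneg (by positivity),
    inv_mul_le_iff₀ (by positivity)]
  linarith

/-- Every element has a smallest spectral value: the least `l` with `l + y` positive makes `l + y`
a boundary point of the cone, hence not invertible. -/
lemma exists_least_spectrum [Nontrivial B] (y : B) :
    ∃ m : ℝ, NormPos (y - m • 1) ∧ m ∈ spectrum ℝ y := by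
  set T : Set ℝ := {l | NormPos (l • (1 : B) + y)} with hT
  have h1 : ‖(1 : B)‖ = 1 := by
    have h := IsAssocJB.norm_sq_eq (1 : B)
    rw [mul_one] at h
    have : ‖(1 : B)‖ ≠ 0 := by simp
    field_simp at h
    exact h.symm
  have hne : T.Nonempty := ⟨‖y‖, normPos_smul_one_add le_rfl⟩
  have hbdd : BddBelow T := by
    refine ⟨-‖y‖, fun l hl => ?_⟩
    by_contra! hlt
    have h2 : NormPos ((0 : ℝ) • (1 : B) - (l • (1 : B) + y)) := by
      have : NormPos ((-l) • (1 : B) - y) := normPos_smul_one_sub (by linarith)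
      convert this using 1; module
    have h3 := norm_le_of_normPos le_rfl (by simpa [hT] using hl) h2
    have h4 : y = (-l) • (1 : B) := by
      have := norm_le_zero_iff.1 h3
      linear_combination (norm := module) this
    have h5 : ‖y‖ = |l| := by rw [h4, norm_smul, h1]; simp
    rw [h5] at hlt
    linarith [neg_abs_le l]
  have hcl : IsClosed T := isClosed_normPos_assoc.preimage (by fun_prop)
  have hm := hcl.csInf_mem hne hbdd
  refine ⟨-sInf T, ?_, ?_⟩
  · have hm' : NormPos (sInf T • (1 : B) + y) := hm
    convert hm' using 1; module
  · rw [spectrum.mem_iff]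
    intro hu
    have hu' : IsUnit (sInf T • (1 : B) + y) := by
      convert hu.neg using 1
      rw [Algebra.algebraMap_eq_smul_one]; module
    obtain ⟨ε, hε, hp⟩ := NormPos.exists_sub_of_isUnit hm hu'
    have : sInf T - ε ∈ T := by
      change NormPos ((sInf T - ε) • (1 : B) + y)
      convert hp using 1; module
    linarith [csInf_le hbdd this]

lemma isUnit_sq_add {x : B} {c : ℝ} (hc : 0 < c) : IsUnit (x * x + c • 1) :=
  (normPos_sq x).isUnit hc

lemma isUnit_quadratic (x : B) (a b c : ℝ) (h0 : ¬(a = 0 ∧ b = 0 ∧ c = 0))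
    (h : ∀ r ∈ spectrum ℝ x, a * r ^ 2 + b * r + c ≠ 0) :
    IsUnit (a • (x * x) + b • x + c • (1 : B)) := by
  have hunit : ∀ r : ℝ, a * r ^ 2 + b * r + c = 0 → IsUnit (x - r • (1 : B)) := by
    intro r hr
    have hr' := mt (h r) (not_not.2 hr)
    rw [spectrum.notMem_iff, Algebra.algebraMap_eq_smul_one] at hr'
    convert hr'.neg using 1; abel
  have hscale : ∀ (a : ℝ) (y : B), a ≠ 0 → IsUnit y → IsUnit (a • y) :=
    fun a y ha hy => hy.smul (Units.mk0 a ha)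
  rcases eq_or_ne a 0 with rfl | ha
  · rcases eq_or_ne b 0 with rfl | hb
    · have hc : c ≠ 0 := fun hc => h0 ⟨rfl, rfl, hc⟩
      simpa using hscale c 1 hc isUnit_one
    · have h1 := hscale b _ hb (hunit (-c / b) (by field_simp; ring))
      convert h1 using 1
      rw [smul_sub, smul_smul, mul_div_cancel₀ _ hb]; module
  · rcases lt_or_ge (b ^ 2 - 4 * a * c) 0 with hd | hd
    · have hd' : 0 < (4 * a * c - b ^ 2) / (4 * a ^ 2) := by
        apply div_pos <;> [linarith; positivity]
      have h1 := hscale a _ ha (isUnit_sq_add (x := x + (b / (2 * a)) • 1) hd')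
      convert h1 using 1
      obtain ⟨e, rfl⟩ : ∃ e, b = 2 * a * e := ⟨b / (2 * a), by field_simp⟩
      have e1 : 2 * a * e / (2 * a) = e := by field_simp
      have e2 : (4 * a * c - (2 * a * e) ^ 2) / (4 * a ^ 2) = c / a - e ^ 2 := by
        field_simp; ring
      obtain ⟨f, rfl⟩ : ∃ f, c = a * f := ⟨c / a, by field_simp⟩
      rw [e1, e2, mul_div_cancel_left₀ _ ha]
      simp only [Algebra.smul_def, map_mul, map_sub, map_pow, map_ofNat]
      ring
    · set s := √(b ^ 2 - 4 * a * c) with hs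
      have hss : s ^ 2 = b ^ 2 - 4 * a * c := Real.sq_sqrt hd
      obtain ⟨e, he⟩ : ∃ e, e = (-b + s) / (2 * a) := ⟨_, rfl⟩
      obtain ⟨f, hf⟩ : ∃ f, f = (-b - s) / (2 * a) := ⟨_, rfl⟩
      have hb' : b = -(a * (e + f)) := by rw [he, hf]; field_simp; ring
      have hc' : c = a * (e * f) := by
        rw [he, hf]; field_simp; linear_combination hss
      have h1 := hscale a _ ha ((hunit e (by rw [hb', hc']; ring)).mul
        (hunit f (by rw [hb', hc']; ring)))
      convert h1 using 1
      rw [hb', hc']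
      simp only [Algebra.smul_def, map_mul, map_neg, map_add]
      ring

/-- A polynomial without zeros on the spectrum of `x` is invertible at `x`: its linear factors are,
and irreducible quadratic factors are of the form `y² + c` with `c > 0`. -/
lemma isUnit_aeval (x : B) (q : ℝ[X]) (hq0 : q ≠ 0) (hq : ∀ r ∈ spectrum ℝ x, q.eval r ≠ 0) :
    IsUnit (aeval x q) := by
  induction q using WfDvdMonoid.induction_on_irreducible with
  | zero => exact absurd rfl hq0
  | unit u hu => exact hu.map (aeval x)
  | mul q p hq0' hp ih =>
    rw [map_mul]
    refine IsUnit.mul ?_ (ih hq0' fun r hr h => hq r hr (by simp [h]))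
    have hpr : ∀ r ∈ spectrum ℝ x, p.eval r ≠ 0 :=
      fun r hr h => hq r hr (by simp [h])
    clear ih hq hq0'
    have hd := hp.degree_le_two
    obtain ⟨a, b, c, rfl⟩ : ∃ a b c : ℝ, p = C a * X ^ 2 + C b * X + C c :=
      ⟨_, _, _, eq_quadratic_of_degree_le_two hd⟩
    have h1 := isUnit_quadratic x a b c
      (fun h => hp.ne_zero (by obtain ⟨rfl, rfl, rfl⟩ := h; simp))
      (fun r hr => by simpa using hpr r hr)
    convert h1 using 1
    simp [Algebra.smul_def, sq]

/-- A polynomial that is nonnegative on the spectrum of `x` is positive at `x`. -/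
lemma normPos_aeval (x : B) (q : ℝ[X]) (hq : ∀ r ∈ spectrum ℝ x, 0 ≤ q.eval r) :
    NormPos (aeval x q) := by
  cases subsingleton_or_nontrivial B with
  | inl h => exact ⟨0, le_rfl, by simp [Subsingleton.elim (aeval x q) 0]⟩
  | inr h =>
    obtain ⟨m, hm, hms⟩ := exists_least_spectrum (aeval x q)
    rcases le_or_gt 0 m with h0 | h0
    · simpa using hm.add (normPos_smul_one h0)
    · exfalso
      have hpos : ∀ r ∈ spectrum ℝ x, (q - C m).eval r ≠ 0 := fun r hr => by
        have := hq r hr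
        rw [eval_sub, eval_C]; linarith
      obtain ⟨l, -, hl⟩ := exists_least_spectrum x
      have hu := isUnit_aeval x (q - C m) (fun h => hpos l hl (by rw [h, eval_zero])) hpos
      rw [spectrum.mem_iff] at hms
      refine hms ?_
      convert hu.neg using 1
      simp

/-- The functional calculus of polynomials is bounded by the supremum on the spectrum. -/
lemma norm_aeval_le (x : B) (q : ℝ[X]) {M : ℝ} (hM : 0 ≤ M)
    (hq : ∀ r ∈ spectrum ℝ x, |q.eval r| ≤ M) : ‖aeval x q‖ ≤ M := by
  have h1 := normPos_aeval x (C M + q) fun r hr => by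
    have := abs_le.1 (hq r hr)
    simp only [eval_add, eval_C]; linarith
  have h2 := normPos_aeval x (C M - q) fun r hr => by
    have := abs_le.1 (hq r hr)
    simp only [eval_sub, eval_C]; linarith
  simp only [map_add, map_sub, aeval_C, Algebra.algebraMap_eq_smul_one] at h1 h2
  exact norm_le_of_normPos hM h1 h2

/-- Multiplication by a non-unit is not bounded below: for small `ε` the lower bound applied to
`y = (z² + ε)⁻¹` gives `‖ε y‖ < 1`, so that `z² y = 1 - ε y` is invertible. -/
lemma isUnit_of_bounded_below {z : B} {k : ℝ} (h : ∀ y : B, ‖y‖ ≤ k * ‖z * y‖) :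
    IsUnit z := by
  cases subsingleton_or_nontrivial B with
  | inl h => exact isUnit_of_subsingleton z
  | inr hC =>
    have hk : 0 ≤ k := by
      by_contra! hk
      have h1 := h 1
      have : 0 < ‖(1 : B)‖ := norm_pos_iff.2 one_ne_zero
      nlinarith [norm_nonneg (z * 1)]
    -- small enough for `‖y‖ ≤ k² (1 + ε ‖y‖)` to give `ε ‖y‖ ≤ 1/3`
    set ε : ℝ := (4 * (k * k) + 1)⁻¹ with hε
    have hε0 : 0 < ε := by positivity
    have hε1 : ε * (4 * (k * k) + 1) = 1 := inv_mul_cancel₀ (by positivity)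
    obtain ⟨y, hy⟩ := (isUnit_sq_add (x := z) hε0).exists_right_inv
    have h1 : z * (z * y) = 1 - ε • y := by
      have : (z * z + ε • 1) * y = z * (z * y) + ε • y := by
        rw [add_mul, smul_mul_assoc, one_mul, mul_assoc]
      rw [← hy, this]; abel
    have h2 : ‖y‖ ≤ k * (k * (1 + ε * ‖y‖)) := by
      refine (h y).trans ?_
      gcongr
      refine (h _).trans ?_
      gcongr
      rw [h1]
      refine (norm_sub_le _ _).trans ?_
      gcongr
      · simpa using norm_smul_one_le (B := B) zero_le_one
      · rw [norm_smul, Real.norm_of_nonneg hε0.le]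
    have h3 : ‖ε • y‖ < 1 := by
      rw [norm_smul, Real.norm_of_nonneg hε0.le]
      have h4 : ε * ‖y‖ ≤ ε * (k * k) * (1 + ε * ‖y‖) := by nlinarith
      have h5 : 0 ≤ ε * ‖y‖ := by positivity
      nlinarith
    have h6 : IsUnit (z * (z * y)) := by rw [h1]; exact (Units.oneSub _ h3).isUnit
    exact isUnit_of_mul_isUnit_left h6

end Assoc

variable {A : Type*} [UnitalJBAlgebra A]

/-! ### The associative subalgebra generated by one element -/

/-- Multiplication by `a` as a linear map. -/
def mulL : A →ₗ[ℝ] Module.End ℝ A := LinearMap.mul ℝ A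

@[simp] lemma mulL_apply (a x : A) : mulL a x = a * x := rfl

/-- The recursion `L_{a(ab)}` in terms of `L_a`, `L_{a²}`, `L_b`, `L_{ab}`: the linearised Jordan
identity read as an equation of operators in one of its symmetric variables. -/
lemma mulL_mul_mul (a b : A) : mulL (a * (a * b)) = mulL (a * a) * mulL b +
    (2 : ℝ) • (mulL (a * b) * mulL a) - mulL a * mulL a * mulL b - mulL b * mulL a * mulL a := by
  ext w
  have h := jordan_linearized a b w a
  simp only [mulL_apply, LinearMap.add_apply, LinearMap.sub_apply, LinearMap.smul_apply,
    Module.End.mul_apply]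
  simp only [mul_comm] at h ⊢
  linear_combination (norm := module) h

/-- Multiplication by a power of `a` commutes with multiplication by `a` and by `a²`. -/
lemma commute_mulL_pow (a : A) (n : ℕ) :
    Commute (mulL ((mulL a ^ n) 1)) (mulL a) ∧ Commute (mulL ((mulL a ^ n) 1)) (mulL (a * a)) := by
  have h0 : Commute (mulL a) (mulL (a * a)) := by
    ext w
    have h := IsCommJordan.lmul_comm_rmul_rmul a w
    simp only [Module.End.mul_apply, mulL_apply]
    rw [mul_comm (a * a) w, ← h, mul_comm]
  induction n using Nat.twoStepInduction with
  | zero =>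
    have : mulL (1 : A) = 1 := by ext w; simp
    simp [this]
  | one => simpa using h0
  | more n ih1 ih2 =>
    set b := (mulL a ^ n) 1 with hb
    have e1 : (mulL a ^ (n + 1)) 1 = a * b := by rw [pow_succ']; simp [hb]
    have e2 : (mulL a ^ (n + 2)) 1 = a * (a * b) := by rw [pow_succ', pow_succ']; simp [hb]
    rw [e1] at ih2
    rw [e2, mulL_mul_mul]
    constructor
    · exact ((((h0.symm.mul_left ih1.1).add_left ((ih2.1.mul_left (Commute.refl _)).smul_left _)
        ).sub_left (((Commute.refl _).mul_left (Commute.refl _)).mul_left ih1.1)).sub_left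
        ((ih1.1.mul_left (Commute.refl _)).mul_left (Commute.refl _)))
    · exact (((((Commute.refl _).mul_left ih1.2).add_left ((ih2.2.mul_left h0).smul_left _)
        ).sub_left ((h0.mul_left h0).mul_left ih1.2)).sub_left
        ((ih1.2.mul_left h0).mul_left h0))

/-- Evaluation of a polynomial at `a`, defined as `p ↦ p(L_a) 1`. -/
def polyEval (a : A) : ℝ[X] →ₗ[ℝ] A :=
  (LinearMap.applyₗ (1 : A)).comp (aeval (mulL a)).toLinearMap

lemma polyEval_apply (a : A) (p : ℝ[X]) : polyEval a p = aeval (mulL a) p 1 := rfl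

lemma polyEval_one (a : A) : polyEval a 1 = 1 := by simp [polyEval_apply]

lemma polyEval_X (a : A) : polyEval a X = a := by simp [polyEval_apply]

lemma commute_mulL_polyEval (a : A) (p q : ℝ[X]) :
    Commute (mulL (polyEval a p)) (aeval (mulL a) q) := by
  have h1 : Commute (mulL (polyEval a p)) (mulL a) := by
    induction p using Polynomial.induction_on' with
    | add p q hp hq => rw [map_add, map_add]; exact hp.add_left hq
    | monomial n c =>
      rw [polyEval_apply, aeval_monomial, Algebra.algebraMap_eq_smul_one, smul_mul_assoc, one_mul,
        LinearMap.smul_apply, map_smul]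
      exact (commute_mulL_pow a n).1.smul_left c
  induction q using Polynomial.induction_on' with
  | add p q hp hq => rw [map_add]; exact hp.add_right hq
  | monomial n c =>
    rw [aeval_monomial]
    exact (Algebra.commute_algebraMap_right _ _).mul_right (h1.pow_right n)

/-- Power associativity. -/
lemma polyEval_mul (a : A) (p q : ℝ[X]) : polyEval a (p * q) = polyEval a p * polyEval a q := by
  have h := LinearMap.congr_fun (commute_mulL_polyEval a p q).eq 1
  simp only [Module.End.mul_apply, mulL_apply, mul_one] at h
  rw [polyEval_apply a q, h, mul_comm p q, polyEval_apply, map_mul]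
  rfl

instance : ContinuousMul A where
  continuous_mul := by
    have := ((LinearMap.mul ℝ A).mkContinuous₂ 1
      (fun x y => by simpa using norm_jmul_le x y)).continuous₂
    exact this

/-- The closed subalgebra generated by `a` and `1`. -/
def assocSub (a : A) : Submodule ℝ A := (LinearMap.range (polyEval a)).topologicalClosure

lemma coe_assocSub (a : A) : (assocSub a : Set A) = closure (Set.range (polyEval a)) := by
  simp [assocSub, Submodule.topologicalClosure_coe, LinearMap.coe_range]

lemma polyEval_mem (a : A) (p : ℝ[X]) : polyEval a p ∈ assocSub a := by
  rw [← SetLike.mem_coe, coe_assocSub]; exact subset_closure ⟨p, rfl⟩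

lemma mul_mem_assocSub {a x y : A} (hx : x ∈ assocSub a) (hy : y ∈ assocSub a) :
    x * y ∈ assocSub a := by
  rw [← SetLike.mem_coe, coe_assocSub] at *
  refine map_mem_closure₂ continuous_mul hx hy ?_
  rintro _ ⟨p, rfl⟩ _ ⟨q, rfl⟩
  exact ⟨p * q, polyEval_mul a p q⟩

lemma mul_assoc_of_mem {a x y z : A} (hx : x ∈ assocSub a) (hy : y ∈ assocSub a)
    (hz : z ∈ assocSub a) : x * y * z = x * (y * z) := by
  rw [← SetLike.mem_coe, coe_assocSub] at *
  have h1 : ∀ p q r, polyEval a p * polyEval a q * polyEval a r =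
      polyEval a p * (polyEval a q * polyEval a r) := fun p q r => by
    simp only [← polyEval_mul, _root_.mul_assoc]
  have h2 : ∀ p q, polyEval a p * polyEval a q * z = polyEval a p * (polyEval a q * z) :=
    fun p q => Set.EqOn.closure (f := fun z => polyEval a p * polyEval a q * z)
      (g := fun z => polyEval a p * (polyEval a q * z)) (by rintro _ ⟨r, rfl⟩; exact h1 p q r)
      (by fun_prop) (by fun_prop) hz
  have h3 : ∀ p, polyEval a p * y * z = polyEval a p * (y * z) :=
    fun p => Set.EqOn.closure (f := fun y => polyEval a p * y * z)
      (g := fun y => polyEval a p * (y * z)) (by rintro _ ⟨r, rfl⟩; exact h2 p r)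
      (by fun_prop) (by fun_prop) hy
  exact Set.EqOn.closure (f := fun x => x * y * z)
      (g := fun x => x * (y * z)) (by rintro _ ⟨r, rfl⟩; exact h3 r)
      (by fun_prop) (by fun_prop) hx

instance (a : A) : CommRing (assocSub a) :=
  { (inferInstance : AddCommGroup (assocSub a)) with
    mul := fun x y => ⟨x.1 * y.1, mul_mem_assocSub x.2 y.2⟩
    one := ⟨1, polyEval_one a ▸ polyEval_mem a 1⟩
    mul_assoc := fun x y z => Subtype.ext (mul_assoc_of_mem x.2 y.2 z.2)
    one_mul := fun x => Subtype.ext (one_mul x.1)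
    mul_one := fun x => Subtype.ext (mul_one x.1)
    zero_mul := fun x => Subtype.ext (zero_mul x.1)
    mul_zero := fun x => Subtype.ext (mul_zero x.1)
    left_distrib := fun x y z => Subtype.ext (mul_add x.1 y.1 z.1)
    right_distrib := fun x y z => Subtype.ext (add_mul x.1 y.1 z.1)
    mul_comm := fun x y => Subtype.ext (mul_comm x.1 y.1) }

instance (a : A) : NormedCommRing (assocSub a) :=
  { (inferInstance : NormedAddCommGroup (assocSub a)), (inferInstance : CommRing (assocSub a)) with
    norm_mul_le := fun x y => norm_jmul_le x.1 y.1 }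

instance (a : A) : NormedAlgebra ℝ (assocSub a) :=
  { Algebra.ofModule (R := ℝ) (A := assocSub a)
      (fun r x y => Subtype.ext (smul_mul_assoc r x.1 y.1))
      (fun r x y => Subtype.ext (mul_smul_comm r x.1 y.1)) with
    norm_smul_le := fun r x => norm_smul_le r x }

instance (a : A) : IsAssocJB (assocSub a) where
  norm_sq_eq x := norm_sq_eq x.1
  norm_sq_le_add x y := norm_sq_le_add x.1 y.1

instance (a : A) : CompleteSpace (assocSub a) :=
  (Submodule.isClosed_topologicalClosure _).completeSpace_coe

/-- `a` as an element of the subalgebra it generates. -/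
def gen (a : A) : assocSub a := ⟨a, by simpa only [polyEval_X] using polyEval_mem a X⟩

lemma coe_aeval_gen (a : A) (p : ℝ[X]) : ((aeval (gen a) p : assocSub a) : A) = polyEval a p := by
  let φ : ℝ[X] →ₐ[ℝ] assocSub a := AlgHom.ofLinearMap
    ((polyEval a).codRestrict (assocSub a) (polyEval_mem a))
    (Subtype.ext (polyEval_one a)) (fun p q => Subtype.ext (polyEval_mul a p q))
  have : aeval (gen a) = φ := by
    ext
    simp only [aeval_X]
    exact (polyEval_X a).symm
  rw [this]; rfl

/-! ### Spectrum and positivity -/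

lemma norm_U_le (x y : A) : ‖U x y‖ ≤ 3 * ‖x‖ ^ 2 * ‖y‖ := by
  have h1 : ‖(x * y) * x‖ ≤ ‖x‖ * ‖y‖ * ‖x‖ :=
    (norm_jmul_le _ _).trans (by gcongr; exact norm_jmul_le _ _)
  have h2 : ‖(x * x) * y‖ ≤ ‖x‖ * ‖x‖ * ‖y‖ :=
    (norm_jmul_le _ _).trans (by gcongr; exact norm_jmul_le _ _)
  refine (norm_sub_le _ _).trans ?_
  rw [norm_smul]
  norm_num
  nlinarith

/-- `U_x` as a continuous linear map. -/
def UCL (x : A) : A →L[ℝ] A := (UL x).mkContinuous (3 * ‖x‖ ^ 2) (norm_U_le x)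

@[simp] lemma UCL_apply (x y : A) : UCL x y = U x y := rfl

lemma isJordanInverse_of_mul_eq_one {a : A} {z w : assocSub a} (h : z * w = 1) :
    IsJordanInverse (z : A) (w : A) := by
  refine ⟨congrArg Subtype.val h, ?_⟩
  have h2 : z * z * w = z := by rw [_root_.mul_assoc, h, _root_.mul_one]
  exact congrArg Subtype.val h2

/-- Jordan invertibility in the whole algebra implies invertibility in the generated associative
subalgebra: if `z` has the Jordan inverse `b`, then `y = U_b (z (z y))` bounds multiplication by `z`
from below. -/
lemma isUnit_iff_isJordanInvertible {a : A} {z : assocSub a} :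
    IsUnit z ↔ IsJordanInvertible (z : A) := by
  constructor
  · intro h
    obtain ⟨w, hw⟩ := h.exists_right_inv
    exact ⟨w, isJordanInverse_of_mul_eq_one hw⟩
  · rintro ⟨b, hb⟩
    refine isUnit_of_bounded_below (k := 3 * ‖b‖ ^ 2 * ‖z‖) fun y => ?_
    have h1 : U (z : A) (y : A) = ((z * (z * y) : assocSub a) : A) := by
      have h2 : ((2 : ℝ) • ((z * y) * z) - (z * z) * y : assocSub a) = z * (z * y) := by
        rw [two_smul]; ring
      exact congrArg Subtype.val h2
    calc ‖y‖ = ‖U b (U (z : A) (y : A))‖ := by rw [hb.U_U']; rfl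
      _ ≤ 3 * ‖b‖ ^ 2 * ‖U (z : A) (y : A)‖ := norm_U_le _ _
      _ ≤ 3 * ‖b‖ ^ 2 * (‖z‖ * ‖z * y‖) := by
        rw [h1]; gcongr; exact norm_mul_le z (z * y)
      _ = _ := by ring

lemma jspectrum_coe {a : A} (z : assocSub a) : jspectrum (z : A) = spectrum ℝ z := by
  ext r
  rw [spectrum.mem_iff, ← IsUnit.neg_iff, isUnit_iff_isJordanInvertible]
  have : ((-(algebraMap ℝ (assocSub a) r - z) : assocSub a) : A) = z - r • (1 : A) := by
    rw [Algebra.algebraMap_eq_smul_one, neg_sub]; rfl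
  rw [this]; rfl

lemma jspectrum_eq (a : A) : jspectrum a = spectrum ℝ (gen a) := jspectrum_coe (gen a)

instance (a : A) : CompactSpace (jspectrum a) := by
  rw [jspectrum_eq, ← isCompact_iff_compactSpace]
  exact spectrum.isCompact _

lemma isClosed_normPos : IsClosed {x : A | NormPos x} := by
  have h : ∀ x : A, NormPos x ↔ ‖‖x‖ • (1 : A) - x‖ ≤ ‖x‖ := fun x =>
    normPos_iff_norm (x := gen x)
  simp only [h]
  exact isClosed_le (by fun_prop) (by fun_prop)

/-- Positive invertible elements are bounded below by a positive scalar. -/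
lemma NormPos.exists_sub {x : A} (hx : NormPos x) (hu : IsJordanInvertible x) :
    ∃ ε : ℝ, 0 < ε ∧ NormPos (x - ε • 1) :=
  NormPos.exists_sub_of_isUnit (x := gen x) hx (isUnit_iff_isJordanInvertible.2 hu)

lemma NormPos.isJordanInvertible {x : A} (hx : NormPos x) {ε : ℝ} (hε : 0 < ε) :
    IsJordanInvertible (x + ε • 1) :=
  isUnit_iff_isJordanInvertible.1 (NormPos.isUnit (x := gen x) hx hε)

lemma NormPos.isJordanInvertible_of_sub {x : A} {ε : ℝ} (hε : 0 < ε) (hx : NormPos (x - ε • 1)) :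
    IsJordanInvertible x := by
  simpa using hx.isJordanInvertible hε

/-- Positivity is characterised by the norm. -/
theorem isJordanPositive_iff_normPos {x : A} : IsJordanPositive x ↔ NormPos x := by
  constructor
  · intro h
    have h1 := normPos_aeval (gen x) X fun r hr => by
      rw [eval_X]; exact h (by rwa [jspectrum_eq])
    rw [aeval_X] at h1
    exact h1
  · intro h r hr
    rw [Set.mem_Ici]
    by_contra! hlt
    refine hr ?_
    have := h.isJordanInvertible (neg_pos.2 hlt)
    rwa [neg_smul, ← sub_eq_add_neg] at this

/-- `U_s b` is positive for invertible `s` and positive invertible `b`. Along the segment from `1`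
to `b` the elements `U_s b_t` remain invertible, and an invertible element of the closed cone is an
interior point, so the segment cannot leave the cone, in which it starts at `U_s 1 = s²`. -/
theorem NormPos.U {s b : A} (hs : IsJordanInvertible s) (hb : NormPos b)
    (hb' : IsJordanInvertible b) : NormPos (U s b) := by
  obtain ⟨ε, hε, hbε⟩ := hb.exists_sub hb'
  set f : ℝ → A := fun t => UCL s ((1 - t) • (1 : A) + t • b) with hf
  have hfc : Continuous f := by fun_prop
  have hinv : ∀ t ∈ Set.Icc (0 : ℝ) 1, IsJordanInvertible (f t) := by
    intro t ht
    have h1 : IsJordanInvertible ((1 - t) • (1 : A) + t • b) := by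
      have hδ : 0 < (1 - t) + t * ε := by
        rcases ht.2.lt_or_eq with h | h
        · nlinarith [mul_nonneg ht.1 hε.le]
        · rw [h]; linarith
      refine NormPos.isJordanInvertible_of_sub hδ ?_
      convert hbε.smul ht.1 using 1
      module
    obtain ⟨c, hc⟩ := h1
    obtain ⟨r, hr⟩ := hs
    exact ⟨_, hr.U hc⟩
  set T : Set ℝ := {t | NormPos (f t)} with hT
  have hTc : IsClosed T := isClosed_normPos.preimage hfc
  have hsub : Set.Icc (0 : ℝ) 1 ⊆ T := by
    refine (hTc.inter isClosed_Icc).Icc_subset_of_forall_exists_gt ?_ ?_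
    · change NormPos (f 0)
      have : f 0 = s * s := by simp [hf, U_one_right]
      rw [this]
      exact normPos_sq (gen s)
    · rintro t ⟨htT, ht⟩ y hy
      obtain ⟨δ, hδ, hp⟩ := NormPos.exists_sub htT (hinv t ⟨ht.1, ht.2.le⟩)
      have hev : ∀ᶠ u in 𝓝[>] t, ‖f u - f t‖ < δ := by
        have h1 := (hfc.sub continuous_const).norm.tendsto (f := fun u => ‖f u - f t‖) t
        simp only [sub_self, norm_zero] at h1
        exact (h1.mono_left nhdsWithin_le_nhds).eventually (gt_mem_nhds hδ)
      obtain ⟨u, hu1, hu2⟩ := (hev.and (Ioc_mem_nhdsGT hy)).exists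
      refine ⟨u, ?_, hu2⟩
      have h3 := hp.add (normPos_smul_one_add hu1.le)
      change NormPos (f u)
      convert h3 using 1
      abel
  have h1 : NormPos (f 1) := hsub ⟨zero_le_one, le_rfl⟩
  simpa [hf] using h1

/-! ### The continuous functional calculus -/

lemma norm_polyEval_le (a : A) (p : ℝ[X]) :
    ‖polyEval a p‖ ≤ ‖toContinuousMapOnAlgHom (jspectrum a) p‖ := by
  rw [← coe_aeval_gen]
  refine norm_aeval_le (gen a) p (norm_nonneg _) fun r hr => ?_
  rw [← jspectrum_eq] at hr
  exact (toContinuousMapOnAlgHom (jspectrum a) p).norm_coe_le_norm ⟨r, hr⟩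

/-- The functional calculus exists: polynomials are dense in `C(Sp a, ℝ)` by the Weierstrass
theorem, and `p ↦ p(a)` is multiplicative and bounded by the supremum norm on the spectrum. -/
theorem exists_isFunctionalCalculus (a : A) :
    ∃ Φ : C(jspectrum a, ℝ) →ₙₐ[ℝ] A, IsFunctionalCalculus a Φ := by
  set e : ℝ[X] →ₗ[ℝ] C(jspectrum a, ℝ) :=
    (toContinuousMapOnAlgHom (jspectrum a)).toLinearMap with he
  have hdense : DenseRange e := by
    have h := polynomialFunctions.topologicalClosure (jspectrum a)
    have h1 : closure (polynomialFunctions (jspectrum a) : Set C(jspectrum a, ℝ)) = Set.univ := by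
      rw [← Subalgebra.topologicalClosure_coe, h]; rfl
    rw [polynomialFunctions_coe] at h1
    exact dense_iff_closure_eq.2 h1
  set F := (polyEval a).extendOfNorm e with hF
  have hFe : ∀ p, F (e p) = polyEval a p :=
    LinearMap.extendOfNorm_eq hdense ⟨1, fun p => by rw [one_mul]; exact norm_polyEval_le a p⟩
  have hmul : ∀ f g, F (f * g) = F f * F g := fun f g =>
    hdense.induction_on₂ (p := fun f g => F (f * g) = F f * F g)
      (isClosed_eq (by fun_prop) (by fun_prop))
      (fun p q => by
        have : e p * e q = e (p * q) := (map_mul (toContinuousMapOnAlgHom (jspectrum a)) p q).symm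
        rw [this, hFe, hFe, hFe, polyEval_mul]) f g
  refine ⟨{ toFun := F, map_smul' := fun r f => map_smul F r f, map_zero' := map_zero F,
            map_add' := map_add F, map_mul' := hmul }, ?_, ?_, F.continuous⟩
  · have : e 1 = 1 := map_one (toContinuousMapOnAlgHom (jspectrum a))
    change F 1 = 1
    rw [← this, hFe, polyEval_one]
  · have : e X = ⟨Subtype.val, continuous_subtype_val⟩ := by
      ext x; simp [he]
    change F ⟨Subtype.val, continuous_subtype_val⟩ = a
    rw [← this, hFe, polyEval_X]

/-- All the elements `f(a)` are obtained from one functional calculus `Φ`. -/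
lemma exists_jcfc_eq (a : A) : ∃ Φ : C(jspectrum a, ℝ) →ₙₐ[ℝ] A, IsFunctionalCalculus a Φ ∧
    ∀ f (hf : ContinuousOn f (jspectrum a)),
      jcfc f a = Φ ⟨(jspectrum a).domRestrict f, hf.domRestrict⟩ :=
  ⟨_, (exists_isFunctionalCalculus a).choose_spec, fun f hf => by
    rw [jcfc, dif_pos ⟨exists_isFunctionalCalculus a, hf⟩]⟩

lemma IsFunctionalCalculus.isJordanInverse {a : A} {Φ : C(jspectrum a, ℝ) →ₙₐ[ℝ] A}
    (h : IsFunctionalCalculus a Φ) {f g : C(jspectrum a, ℝ)} (hfg : f * g = 1) :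
    IsJordanInverse (Φ f) (Φ g) := by
  refine ⟨by rw [← map_mul, hfg, h.map_one], ?_⟩
  rw [← map_mul, ← map_mul, _root_.mul_assoc, hfg, _root_.mul_one]

/-- The functional calculus as a continuous linear map. -/
def IsFunctionalCalculus.toCLM {a : A} {Φ : C(jspectrum a, ℝ) →ₙₐ[ℝ] A}
    (h : IsFunctionalCalculus a Φ) : C(jspectrum a, ℝ) →L[ℝ] A where
  toFun := Φ
  map_add' := map_add Φ
  map_smul' := map_smul Φ
  cont := h.continuous

lemma pos_of_mem_jspectrum {a : A} (ha : IsJordanPositive a) (ha' : IsJordanInvertible a) {r : ℝ}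
    (hr : r ∈ jspectrum a) : 0 < r := by
  refine lt_of_le_of_ne (ha hr) ?_
  rintro rfl
  exact hr (by simpa using ha')

/-! ### The scalar integral representation of the logarithm -/

lemma harmonic_denom_pos {x t : ℝ} (hx : 0 < x) (ht : t ∈ Set.Icc (0 : ℝ) 1) :
    0 < (1 - t) * x + t := by
  rcases ht.2.lt_or_eq with h | h
  · nlinarith [ht.1, mul_pos (sub_pos.2 h) hx]
  · rw [h]; norm_num

/-- `log x` is the integral over `[0,1]` of the difference quotients of the scalar harmonic means
of `1` and `x`. -/
lemma integral_harmonic_eq_log {x : ℝ} (hx : 0 < x) :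
    ∫ t in (0 : ℝ)..1, (x - 1) / ((1 - t) * x + t) = Real.log x := by
  have h1 : ∀ t ∈ Set.uIcc (0 : ℝ) 1,
      HasDerivAt (fun t => -Real.log ((1 - t) * x + t)) ((x - 1) / ((1 - t) * x + t)) t := by
    intro t ht
    rw [Set.uIcc_of_le zero_le_one] at ht
    have h2 : HasDerivAt (fun t : ℝ => (1 - t) * x + t) ((-1) * x + 1) t :=
      (((hasDerivAt_id t).const_sub 1).mul_const x).add (hasDerivAt_id t)
    have h3 := (h2.log (harmonic_denom_pos hx ht).ne').neg
    rwa [← neg_div, neg_add, neg_one_mul, neg_neg, ← sub_eq_add_neg] at h3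
  rw [intervalIntegral.integral_eq_sub_of_hasDerivAt h1]
  · simp
  · refine ContinuousOn.intervalIntegrable ?_
    rw [Set.uIcc_of_le zero_le_one]
    exact ContinuousOn.div (by fun_prop) (by fun_prop)
      fun t ht => (harmonic_denom_pos hx ht).ne'

/-- The functions `x ↦ (x - 1) / ((1 - t) x + t)` on a set of positive numbers, as a continuous
family in `t`; `t` is first projected to `[0,1]`, where the denominator does not vanish. -/
def harmonicFamily {K : Set ℝ} (hK : ∀ x ∈ K, 0 < x) (t : ℝ) : C(K, ℝ) :=
  ContinuousMap.curry (X := Set.Icc (0 : ℝ) 1) (Y := K)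
    ⟨fun q => ((q.2 : ℝ) - 1) / ((1 - (q.1 : ℝ)) * q.2 + q.1),
      Continuous.div (by fun_prop) (by fun_prop)
        fun q => (harmonic_denom_pos (hK _ q.2.2) q.1.2).ne'⟩
    (Set.projIcc 0 1 zero_le_one t)

lemma continuous_harmonicFamily {K : Set ℝ} (hK : ∀ x ∈ K, 0 < x) :
    Continuous (harmonicFamily hK) :=
  (ContinuousMap.continuous _).comp continuous_projIcc

lemma harmonicFamily_apply {K : Set ℝ} (hK : ∀ x ∈ K, 0 < x) {t : ℝ} (ht : t ∈ Set.Icc (0 : ℝ) 1)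
    (x : K) : harmonicFamily hK t x = ((x : ℝ) - 1) / ((1 - t) * x + t) := by
  rw [harmonicFamily, Set.projIcc_of_mem zero_le_one ht]; rfl

lemma integral_harmonicFamily {K : Set ℝ} [CompactSpace K] (hK : ∀ x ∈ K, 0 < x) (x : K) :
    (∫ t in (0 : ℝ)..1, harmonicFamily hK t) x = Real.log x := by
  have h := (ContinuousMap.evalCLM ℝ x).intervalIntegral_comp_comm
    ((continuous_harmonicFamily hK).intervalIntegrable (μ := MeasureTheory.volume) 0 1)
  rw [ContinuousMap.evalCLM_apply] at h
  rw [← h, ← integral_harmonic_eq_log (hK x x.2)]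
  refine intervalIntegral.integral_congr fun t ht => ?_
  rw [Set.uIcc_of_le zero_le_one] at ht
  exact harmonicFamily_apply hK ht x

end UnitalJBAlgebra

open UnitalJBAlgebra in
theorem mainTheorem5 {A : Type*} [UnitalJBAlgebra A] (a b : A)
    (ha : UnitalJBAlgebra.IsJordanPositive a) (ha' : UnitalJBAlgebra.IsJordanInvertible a)
    (hb : UnitalJBAlgebra.IsJordanPositive b) (hb' : UnitalJBAlgebra.IsJordanInvertible b) :
    (∀ t ∈ Set.Icc (0 : ℝ) 1, UnitalJBAlgebra.IsJordanInvertible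
      ((1 - t) • UnitalJBAlgebra.jinv a + t • UnitalJBAlgebra.jinv b)) ∧
    IntervalIntegrable (fun t : ℝ => t⁻¹ • (UnitalJBAlgebra.harmonicMean t a b - a))
      MeasureTheory.volume 0 1 ∧
    UnitalJBAlgebra.relativeOperatorEntropy a b =
      ∫ t in (0 : ℝ)..1, t⁻¹ • (UnitalJBAlgebra.harmonicMean t a b - a) := by
  obtain ⟨Φ, hΦ, hΦ'⟩ := exists_jcfc_eq a
  have hapos : ∀ x ∈ jspectrum a, 0 < x := fun x hx => pos_of_mem_jspectrum ha ha' hx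
  have hcont : ∀ p : ℝ, ContinuousOn (fun x : ℝ => x ^ p) (jspectrum a) := fun p =>
    continuousOn_id.rpow_const fun x hx => Or.inl (hapos x hx).ne'
  -- the square root of `a` and its inverse
  set s := jpow a (1 / 2) with hs
  set r := jpow a (-(1 / 2)) with hr
  have hs' : s = Φ _ := hΦ' _ (hcont (1 / 2))
  have hr' : r = Φ _ := hΦ' _ (hcont (-(1 / 2)))
  have hsr : IsJordanInverse s r := by
    rw [hs', hr']
    refine hΦ.isJordanInverse ?_
    ext x
    change (x : ℝ) ^ (1 / 2 : ℝ) * (x : ℝ) ^ (-(1 / 2) : ℝ) = 1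
    rw [← Real.rpow_add (hapos x x.2)]
    norm_num
  have hsa : U s 1 = a := by
    rw [U_one_right, hs', ← map_mul]
    refine Eq.trans (congrArg Φ ?_) hΦ.map_id
    ext x
    change (x : ℝ) ^ (1 / 2 : ℝ) * (x : ℝ) ^ (1 / 2 : ℝ) = x
    rw [← Real.rpow_add (hapos x x.2)]
    norm_num
  have hone : IsJordanInverse (1 : A) 1 := ⟨by simp, by simp⟩
  have hainv : jinv a = U r 1 := by
    have h := hsr.U hone
    rw [hsa] at h
    exact h.jinv_eq
  -- `c = {a^{-1/2} b a^{-1/2}}` is positive and invertible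
  set c := U r b with hc
  have hbb := hb'.isJordanInverse_jinv
  have hcc : IsJordanInverse c (U s (jinv b)) := hsr.symm.U hbb
  have hcpos' : IsJordanPositive c := isJordanPositive_iff_normPos.2
    (NormPos.U ⟨s, hsr.symm⟩ (isJordanPositive_iff_normPos.1 hb) hb')
  have hcpos : ∀ x ∈ jspectrum c, 0 < x :=
    fun x hx => pos_of_mem_jspectrum hcpos' hcc.isJordanInvertible hx
  obtain ⟨Ψ, hΨ, hΨ'⟩ := exists_jcfc_eq c
  have hlog : jlog c = Ψ _ :=
    hΨ' Real.log (Real.continuousOn_log.mono fun x hx => (hcpos x hx).ne')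
  have hcinv : U s (jinv b) = Ψ ⟨fun x => (x : ℝ)⁻¹,
      continuous_subtype_val.inv₀ fun x => (hcpos x x.2).ne'⟩ := by
    refine hcc.unique ?_
    have h := hΨ.isJordanInverse (f := ⟨Subtype.val, continuous_subtype_val⟩)
      (g := ⟨fun x => (x : ℝ)⁻¹, continuous_subtype_val.inv₀ fun x => (hcpos x x.2).ne'⟩)
      (by ext x; exact mul_inv_cancel₀ (hcpos x x.2).ne')
    rwa [hΨ.map_id] at h
  -- with `g_t x = (x - 1) / ((1 - t) x + t)`, the weighted sum of the inverses is `U_r` of the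
  -- function `(1 - t) + t / x` at `c`, with inverse `U_s` of the reciprocal function `1 + t g_t`
  -- at `c`
  have hmean : ∀ t ∈ Set.Icc (0 : ℝ) 1, IsJordanInverse ((1 - t) • jinv a + t • jinv b)
      (a + t • U s (Ψ (harmonicFamily hcpos t))) := by
    intro t ht
    have e1 : (1 - t) • jinv a + t • jinv b = U r (Ψ ((1 - t) • 1 + t • ⟨fun x => (x : ℝ)⁻¹,
        continuous_subtype_val.inv₀ fun x => (hcpos x x.2).ne'⟩)) := by
      rw [map_add, map_smul, map_smul, hΨ.map_one, ← hcinv, ← UL_apply r, map_add, map_smul,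
        map_smul, UL_apply, UL_apply, hsr.U_U', hainv]
    have e2 : a + t • U s (Ψ (harmonicFamily hcpos t)) =
        U s (Ψ (1 + t • harmonicFamily hcpos t)) := by
      rw [map_add, map_smul, hΨ.map_one, ← UL_apply s, ← UL_apply s, map_add, map_smul, UL_apply,
        UL_apply, hsa]
    rw [e1, e2]
    refine hsr.symm.U (hΨ.isJordanInverse ?_)
    ext x
    have hx := hcpos x x.2
    have hd := (harmonic_denom_pos hx ht).ne'
    change ((1 - t) * 1 + t * (x : ℝ)⁻¹) * (1 + t * harmonicFamily hcpos t x) = 1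
    rw [harmonicFamily_apply hcpos ht]
    field_simp
    ring
  set L : C(jspectrum c, ℝ) →L[ℝ] A := (UCL s).comp hΨ.toCLM with hL
  have hLG : Continuous fun t => L (harmonicFamily hcpos t) :=
    L.continuous.comp (continuous_harmonicFamily hcpos)
  -- the point `t = 0`, where the right-hand side is a junk value, is not in the half-open interval
  have hint : ∀ t ∈ Set.uIoc (0 : ℝ) 1,
      L (harmonicFamily hcpos t) = t⁻¹ • (harmonicMean t a b - a) := by
    intro t ht
    rw [Set.uIoc_of_le zero_le_one] at ht
    rw [harmonicMean, (hmean t ⟨ht.1.le, ht.2⟩).jinv_eq, add_sub_cancel_left, smul_smul,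
      inv_mul_cancel₀ ht.1.ne', one_smul]
    rfl
  refine ⟨fun t ht => (hmean t ht).isJordanInvertible, ?_, ?_⟩
  · exact (hLG.intervalIntegrable 0 1).congr hint
  · rw [← intervalIntegral.integral_congr_ae (MeasureTheory.ae_of_all _ hint),
      L.intervalIntegral_comp_comm ((continuous_harmonicFamily hcpos).intervalIntegrable 0 1)]
    change U s (jlog c) = U s (Ψ _)
    rw [hlog]
    congr 2
    ext x
    exact (integral_harmonicFamily hcpos x).symm

end
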